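/- **Theorem (Bochner formula).** Let $(X,J,g)$ be a complex manifold of complex dimension $n$ with a smooth Hermitian metric, with fundamental form $\omega=\sqrt{-1}\,g_{i\bar j}\,dz^i\wedge d\bar z^j$ in local holomorphic coordinates, and let $\rho=\sqrt{-1}\,\rho_{i\bar j}\,dz^i\wedge d\bar z^j$ be a smooth real closed $(1,1)$-form on $X$ whose trace $g^{i\bar j}\rho_{i\bar j}$ is constant on $X$. Then in all local holomorphic coordinates $$g^{i\bar j}\partial_i\partial_{\bar j}|\rho|^2 = 2|\nabla^+\rho|^2 + 2\,Q_{i\bar j k\bar l}\left(g^{i\bar j}(\rho^2)^{k\bar l}-\rho^{i\bar j}\rho^{k\bar l}\right).$$ Here repeated indices are summed, $g^{i\bar m}g_{j\bar m}=\delta^i_j$, indices are raised and lowered with $g$ (so $\rho^{i\bar j}=g^{i\bar q}g^{p\bar j}\rho_{p\bar q}$), $|\rho|^2=g^{p\bar q}g^{k\bar l}\rho_{k\bar q}\rho_{p\bar l}$ and $(\rho^2)_{k\bar l}=g^{p\bar q}\rho_{k\bar q}\rho_{p\bar l}$. With the Chern connection coefficients $\Gamma_{ki}^j=g^{j\bar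 m}\partial_k g_{i\bar m}$, the Chern torsion is $T_{ij}^k=\Gamma_{ij}^k-\Gamma_{ji}^k$, $T_{ij\bar k}=g_{m\bar k}T_{ij}^m$, the Chern curvature is $R_{i\bar jk}{}^{l}=-\partial_{\bar j}\Gamma_{ik}^l$, $R_{i\bar jk\bar l}=g_{m\bar l}R_{i\bar jk}{}^{m}$, and $$Q_{i\bar jk\bar l}=R_{i\bar jk\bar l}-g^{p\bar q}T_{kp\bar j}\overline{T_{lq\bar i}}.$$ The Bismut connection $\nabla^+$ on $T^{1,0}X$ is $\nabla^+_iX^j=\partial_iX^j+\Gamma_{li}^jX^l$, $\nabla^+_{\bar i}X^j=\partial_{\bar i}X^j+g^{j\bar m}\overline{T_{im\bar l}}X^l$. It induces, together with its conjugate on $T^{0,1}X$, the derivative $$\nabla^+_k\rho_{i\bar m}=\partial_k\rho_{i\bar m}-\Gamma_{ik}^p\rho_{p\bar m}-\overline{g^{q\bar s}\,\overline{T_{ks\bar m}}}\;\rho_{i\bar q},$$ and $|\nabla^+\rho|^2=g^{k\bar l}g^{i\bar j}g^{p\bar q}\,\nabla^+_k\rho_{i\bar q}\,\overline{\nabla^+_l\rho_{j\bar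 p}}$ is the squared norm of this $(1,0)$-part of $\nabla^+\rho$. -/

import Mathlib

open scoped Manifold ContDiff ComplexConjugate

noncomputable section

namespace HermitianGeometry

/-! ### Complex manifolds, tangent vectors and charts

A complex manifold of dimension `n` is a space `X` with
`[ChartedSpace (Fin n → ℂ) X] [IsManifold 𝓘(ℂ, Fin n → ℂ) ω X]`. Its tangent spaces are complex
vector spaces, and the complex structure `J` is multiplication by `Complex.I`. Holomorphic
coordinates are the elements of the maximal holomorphic atlas. -/

/-- The holomorphic charts of the complex manifold `X`. -/
def holCharts (n : ℕ) (X : Type*) [TopologicalSpace X] [ChartedSpace (Fin n → ℂ) X] :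
    Set (OpenPartialHomeomorph X (Fin n → ℂ)) :=
  IsManifold.maximalAtlas 𝓘(ℂ, Fin n → ℂ) ω X

/-- The differential at `z` of the parametrization `e.symm`, as a real linear map: it sends a
vector of `ℂⁿ` to the tangent vector of `X` which has these coordinates in the chart `e`. -/
def chartVec {n : ℕ} {X : Type*} [TopologicalSpace X] [ChartedSpace (Fin n → ℂ) X]
    (e : OpenPartialHomeomorph X (Fin n → ℂ)) (z : Fin n → ℂ) :
    (Fin n → ℂ) →L[ℝ] TangentSpace 𝓘(ℂ, Fin n → ℂ) (e.symm z) :=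
  (show (Fin n → ℂ) →L[ℂ] TangentSpace 𝓘(ℂ, Fin n → ℂ) (e.symm z) from
    mfderiv 𝓘(ℂ, Fin n → ℂ) 𝓘(ℂ, Fin n → ℂ) e.symm z).restrictScalars ℝ

/-- A smooth Hermitian metric on the complex manifold `X`: a smooth Riemannian metric which is
invariant under the complex structure. -/
structure HermitianMetric (n : ℕ) (X : Type*) [TopologicalSpace X]
    [ChartedSpace (Fin n → ℂ) X] where
  /-- The real inner product on each tangent space. -/
  inner (x : X) : TangentSpace 𝓘(ℂ, Fin n → ℂ) x →ₗ[ℝ] TangentSpace 𝓘(ℂ, Fin n → ℂ) x →ₗ[ℝ] ℝ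
  symm : ∀ x u v, inner x u v = inner x v u
  pos : ∀ x u, u ≠ 0 → 0 < inner x u u
  invariant : ∀ x u v, inner x (Complex.I • u) (Complex.I • v) = inner x u v
  smooth : ∀ e ∈ holCharts n X, ∀ u v : Fin n → ℂ,
    ContDiffOn ℝ ∞ (fun z => inner (e.symm z) (chartVec e z u) (chartVec e z v)) e.target

/-- A field of real alternating bilinear forms on the tangent spaces of `X`. -/
abbrev RealTwoForm (n : ℕ) (X : Type*) [TopologicalSpace X] [ChartedSpace (Fin n → ℂ) X] :
    Type _ :=
  ∀ x : X, TangentSpace 𝓘(ℂ, Fin n → ℂ) x [⋀^Fin 2]→L[ℝ] ℝ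

namespace RealTwoForm

variable {n : ℕ} {X : Type*} [TopologicalSpace X] [ChartedSpace (Fin n → ℂ) X]

/-- The form written in the chart `e`, that is, its pullback under `e.symm`. -/
def inChart (ρ : RealTwoForm n X) (e : OpenPartialHomeomorph X (Fin n → ℂ)) (z : Fin n → ℂ) :
    (Fin n → ℂ) [⋀^Fin 2]→L[ℝ] ℝ :=
  (ρ (e.symm z)).compContinuousLinearMap (chartVec e z)

/-- The form is smooth. -/
def IsSmooth (ρ : RealTwoForm n X) : Prop :=
  ∀ e ∈ holCharts n X, ContDiffOn ℝ ∞ (ρ.inChart e) e.target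

/-- The form is of type `(1,1)`: `ρ(Ju, Jv) = ρ(u, v)`. -/
def IsOneOne (ρ : RealTwoForm n X) : Prop :=
  ∀ (x : X) (u v : TangentSpace 𝓘(ℂ, Fin n → ℂ) x),
    ρ x ![Complex.I • u, Complex.I • v] = ρ x ![u, v]

/-- The form is closed: its exterior derivative vanishes. -/
def IsClosedForm (ρ : RealTwoForm n X) : Prop :=
  ∀ e ∈ holCharts n X, ∀ z ∈ e.target, extDeriv (ρ.inChart e) z = 0

end RealTwoForm

/-! ### Holomorphic coordinates: Wirtinger derivatives and components -/

section Coordinates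

variable {n : ℕ}

/-- The coordinate vector `∂/∂xₖ` of `ℂⁿ`, where `zₖ = xₖ + i yₖ`. -/
def vecX (k : Fin n) : Fin n → ℂ := Pi.single k 1

/-- The coordinate vector `∂/∂yₖ = J ∂/∂xₖ` of `ℂⁿ`. -/
def vecY (k : Fin n) : Fin n → ℂ := Pi.single k Complex.I

/-- `∂ₖ f = ½ (∂f/∂xₖ - i ∂f/∂yₖ)`. -/
def dz (k : Fin n) (f : (Fin n → ℂ) → ℂ) (z : Fin n → ℂ) : ℂ :=
  (1 / 2) * (fderiv ℝ f z (vecX k) - Complex.I * fderiv ℝ f z (vecY k))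

/-- `∂_{k̄} f = ½ (∂f/∂xₖ + i ∂f/∂yₖ)`. -/
def dzbar (k : Fin n) (f : (Fin n → ℂ) → ℂ) (z : Fin n → ℂ) : ℂ :=
  (1 / 2) * (fderiv ℝ f z (vecX k) + Complex.I * fderiv ℝ f z (vecY k))

/-- The value at `(∂ᵢ, ∂_{j̄})` of the complex bilinear extension of a real bilinear form `B`,
where `∂ᵢ = ½ (∂/∂xᵢ - i ∂/∂yᵢ)` and `∂_{j̄} = ½ (∂/∂xⱼ + i ∂/∂yⱼ)`. -/
def mixedComponent (B : (Fin n → ℂ) → (Fin n → ℂ) → ℝ) (i j : Fin n) : ℂ :=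
  (1 / 4) * ((B (vecX i) (vecX j) : ℂ) + (B (vecY i) (vecY j) : ℂ)
    + Complex.I * ((B (vecX i) (vecY j) : ℂ) - (B (vecY i) (vecX j) : ℂ)))

/-- A field of matrices on (a domain of) `ℂⁿ`; `A z i j` stands for `A_{i j̄}` at `z`. -/
abbrev MatrixField (n : ℕ) : Type := (Fin n → ℂ) → Matrix (Fin n) (Fin n) ℂ

end Coordinates

section Components

variable {n : ℕ} {X : Type*} [TopologicalSpace X] [ChartedSpace (Fin n → ℂ) X]

/-- The components `g_{i j̄} = g(∂ᵢ, ∂_{j̄})` of the metric in the chart `e`, so that the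
fundamental form `ω(u, v) = g(Ju, v)` is `√-1 ∑ g_{i j̄} dzⁱ ∧ dz̄ʲ`. -/
def HermitianMetric.comp (g : HermitianMetric n X) (e : OpenPartialHomeomorph X (Fin n → ℂ)) :
    MatrixField n := fun z =>
  Matrix.of fun i j =>
    mixedComponent (fun u v => g.inner (e.symm z) (chartVec e z u) (chartVec e z v)) i j

/-- The components `ρ_{i j̄} = -√-1 ρ(∂ᵢ, ∂_{j̄})` of a form in the chart `e`, so that a form of
type `(1,1)` is `√-1 ∑ ρ_{i j̄} dzⁱ ∧ dz̄ʲ`. -/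
def RealTwoForm.comp (ρ : RealTwoForm n X) (e : OpenPartialHomeomorph X (Fin n → ℂ)) :
    MatrixField n := fun z =>
  Matrix.of fun i j => -Complex.I * mixedComponent (fun u v => ρ.inChart e z ![u, v]) i j

end Components

/-! ### Tensor calculus in holomorphic coordinates

Below `G` is the field of components `g_{i j̄}` of the metric and `P` the field of components
`ρ_{i j̄}` of a `(1,1)`-form, in one chart. -/

section Tensors

variable {n : ℕ} (G P : MatrixField n)

/-- `g^{i j̄}`, the inverse of the metric: `∑ₘ g^{i m̄} g_{j m̄} = δⁱⱼ`. -/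
def gUp (z : Fin n → ℂ) (i j : Fin n) : ℂ := (G z)⁻¹ j i

/-- The Chern connection coefficients `Γ_{ki}^j = g^{j m̄} ∂ₖ g_{i m̄}`;
`∇ₖ Xʲ = ∂ₖ Xʲ + Γ_{ki}^j Xⁱ` and `∇_{k̄} Xʲ = ∂_{k̄} Xʲ`. -/
def chernGamma (k i j : Fin n) (z : Fin n → ℂ) : ℂ :=
  ∑ m, gUp G z j m * dz k (fun w => G w i m) z

/-- The torsion of the Chern connection, `T_{ij}^k = Γ_{ij}^k - Γ_{ji}^k`. -/
def chernTorsion (i j k : Fin n) (z : Fin n → ℂ) : ℂ :=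
  chernGamma G i j k z - chernGamma G j i k z

/-- `T_{ij k̄} = g_{m k̄} T_{ij}^m`. -/
def chernTorsionLow (i j k : Fin n) (z : Fin n → ℂ) : ℂ :=
  ∑ m, G z m k * chernTorsion G i j m z

/-- The curvature of the Chern connection, `R_{i j̄ k}^l = -∂_{j̄} Γ_{ik}^l`. -/
def chernCurvature (i j k l : Fin n) (z : Fin n → ℂ) : ℂ :=
  -dzbar j (chernGamma G i k l) z

/-- `R_{i j̄ k l̄} = g_{m l̄} R_{i j̄ k}^m`. -/
def chernCurvatureLow (i j k l : Fin n) (z : Fin n → ℂ) : ℂ :=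
  ∑ m, G z m l * chernCurvature G i j k m z

/-- `Q_{i j̄ k l̄} = R_{i j̄ k l̄} - g^{p q̄} T_{kp j̄} conj(T_{lq ī})`. -/
def tensorQ (i j k l : Fin n) (z : Fin n → ℂ) : ℂ :=
  chernCurvatureLow G i j k l z -
    ∑ p, ∑ q, gUp G z p q * chernTorsionLow G k p j z * conj (chernTorsionLow G l q i z)

/-- The coefficients `A_{k l}^j = Γ_{lk}^j` of the Bismut connection on `T^{1,0}`:
`∇⁺ₖ Xʲ = ∂ₖ Xʲ + A_{k l}^j Xˡ`. -/
def bismutA (k l j : Fin n) (z : Fin n → ℂ) : ℂ := chernGamma G l k j z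

/-- The coefficients `A_{k̄ l}^j = g^{j m̄} conj(T_{km l̄})` of the Bismut connection on `T^{1,0}`:
`∇⁺_{k̄} Xʲ = ∂_{k̄} Xʲ + A_{k̄ l}^j Xˡ`. -/
def bismutAbar (k l j : Fin n) (z : Fin n → ℂ) : ℂ :=
  ∑ m, gUp G z j m * conj (chernTorsionLow G k m l z)

/-- The Bismut derivative `∇⁺ₖ ρ_{i m̄}`, for the connection which the Bismut connection on
`T^{1,0}` and its conjugate on `T^{0,1}` (with coefficients `conj(A_{k̄ m}^q)` in the direction
`∂ₖ`) induce on `(1,1)`-tensors. -/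
def bismutDeriv (k i m : Fin n) (z : Fin n → ℂ) : ℂ :=
  dz k (fun w => P w i m) z - ∑ p, bismutA G k i p z * P z p m
    - ∑ q, conj (bismutAbar G k m q z) * P z i q

/-- `|∇⁺ρ|² = g^{k l̄} g^{i j̄} g^{p q̄} ∇⁺ₖ ρ_{i q̄} conj(∇⁺ₗ ρ_{j p̄})`. -/
def bismutDerivNormSq (z : Fin n → ℂ) : ℂ :=
  ∑ k, ∑ l, ∑ i, ∑ j, ∑ p, ∑ q, gUp G z k l * gUp G z i j * gUp G z p q *
    bismutDeriv G P k i q z * conj (bismutDeriv G P l j p z)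

/-- The trace `g^{i j̄} ρ_{i j̄}`. -/
def traceForm (z : Fin n → ℂ) : ℂ := ∑ i, ∑ j, gUp G z i j * P z i j

/-- `|ρ|² = g^{p q̄} g^{k l̄} ρ_{k q̄} ρ_{p l̄}`. -/
def formNormSq (z : Fin n → ℂ) : ℂ :=
  ∑ p, ∑ q, ∑ k, ∑ l, gUp G z p q * gUp G z k l * P z k q * P z p l

/-- `(ρ²)_{k l̄} = g^{p q̄} ρ_{k q̄} ρ_{p l̄}`. -/
def formSq : MatrixField n := fun z =>
  Matrix.of fun k l => ∑ p, ∑ q, gUp G z p q * P z k q * P z p l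

/-- Raising both indices: `A^{i j̄} = g^{i q̄} g^{p j̄} A_{p q̄}`. -/
def raise (A : MatrixField n) (i j : Fin n) (z : Fin n → ℂ) : ℂ :=
  ∑ p, ∑ q, gUp G z i q * gUp G z p j * A z p q

/-- The Chern Laplacian `g^{i j̄} ∂ᵢ ∂_{j̄} f` of a function. -/
def chernLaplacian (f : (Fin n → ℂ) → ℂ) (z : Fin n → ℂ) : ℂ :=
  ∑ i, ∑ j, gUp G z i j * dz i (dzbar j f) z

end Tensors

end HermitianGeometry

end

open HermitianGeometry

/-! In a chart put H = G⁻¹ and S = P H, the endomorphism attached to ρ; then the trace of ρ is tr S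
and |ρ|² = tr S². Differentiating S twice gives ∂ᵢ∂_{j̄}S = E_{ij} H plus a commutator, where E_{ij}
consists of the mixed second derivatives W_{ij} of P, products of first derivatives, and P H R_{ij}
with R the Chern curvature. The commutator is traceless, so constancy of tr S says tr(E_{ij} H) = 0.
In the Laplacian of tr S² the commutator turns ∂S into the Chern derivative, and one finds Δ|ρ|² = 2
(Σ H_{ji} tr(E_{ij} M) + |∇ρ|²), where M = H P H is ρ with raised indices.

Closedness of ρ makes W_{i j̄ k l̄} invariant under exchanging the index pairs (i, j̄) and (k, l̄).
Hence the term Σ H_{ji} tr(W_{ij} M) equals Σ M_{ji} tr(W_{ij} H), which the trace condition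
expresses through the curvature and first derivatives. The curvature terms are those of the theorem
with R in place of Q. In the first-order terms the exchange replaces ∂ᵢg_{k ā} by ∂ₖg_{i ā}, and the
difference is the torsion. What remains completes a square: |∇ρ|² plus the cross terms is |∇⁺ρ|², up
to products T T̄ that turn R into Q.

This last computation is the purely algebraic `bochner_algebra`, driven by `contract_swap`. The
matrix form of the tensors comes from `chernCurvatureLow_eq`, `bismutDerivNormSq_eq` and
`sum_tensorQ_mul`; `bochner_formula_of_isOpen` supplies the calculus. On the manifold,
`det_comp_ne_zero` and `dz_comp_comm` supply invertibility of G and closedness in complex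
coordinates. -/

noncomputable section

namespace HermitianGeometry

/-! ### Calculus of Wirtinger derivatives -/

section Wirtinger

variable {n : ℕ}

/-- The derivation `½ (∂/∂xₖ + c ∂/∂yₖ)`, which is `∂ₖ` for `c = -i` and `∂_{k̄}` for `c = i`. -/
def wirtinger (c : ℂ) (k : Fin n) (f : (Fin n → ℂ) → ℂ) (z : Fin n → ℂ) : ℂ :=
  (1 / 2) * (fderiv ℝ f z (vecX k) + c * fderiv ℝ f z (vecY k))

lemma dz_eq_wirtinger : (dz : Fin n → _) = wirtinger (-Complex.I) := by
  ext k f z; simp [dz, wirtinger]; ring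

lemma dzbar_eq_wirtinger : (dzbar : Fin n → _) = wirtinger Complex.I := rfl

variable {c : ℂ} {k : Fin n} {f g : (Fin n → ℂ) → ℂ} {z : Fin n → ℂ}

lemma wirtinger_const (a : ℂ) : wirtinger c k (fun _ => a) z = 0 := by
  simp [wirtinger]

lemma wirtinger_mul (hf : DifferentiableAt ℝ f z) (hg : DifferentiableAt ℝ g z) :
    wirtinger c k (fun w => f w * g w) z = wirtinger c k f z * g z + f z * wirtinger c k g z := by
  simp only [wirtinger, fderiv_fun_mul hf hg]
  simp; ring

lemma wirtinger_add (hf : DifferentiableAt ℝ f z) (hg : DifferentiableAt ℝ g z) :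
    wirtinger c k (fun w => f w + g w) z = wirtinger c k f z + wirtinger c k g z := by
  simp only [wirtinger, fderiv_fun_add hf hg]
  simp; ring

lemma wirtinger_sub (hf : DifferentiableAt ℝ f z) (hg : DifferentiableAt ℝ g z) :
    wirtinger c k (fun w => f w - g w) z = wirtinger c k f z - wirtinger c k g z := by
  simp only [wirtinger, fderiv_fun_sub hf hg]
  simp; ring

lemma wirtinger_sum {ι : Type*} {s : Finset ι} {F : ι → (Fin n → ℂ) → ℂ}
    (hF : ∀ i ∈ s, DifferentiableAt ℝ (F i) z) :
    wirtinger c k (fun w => ∑ i ∈ s, F i w) z = ∑ i ∈ s, wirtinger c k (F i) z := by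
  simp only [wirtinger, fderiv_fun_sum hF]
  simp [Finset.mul_sum, Finset.sum_add_distrib, mul_add]

lemma wirtinger_congr (h : f =ᶠ[nhds z] g) : wirtinger c k f z = wirtinger c k g z := by
  simp only [wirtinger, h.fderiv_eq]

lemma wirtinger_conj (f : (Fin n → ℂ) → ℂ) :
    wirtinger c k (fun w => conj (f w)) z = conj (wirtinger (conj c) k f z) := by
  have h : fderiv ℝ (fun w => conj (f w)) z =
      (Complex.conjCLE : ℂ →L[ℝ] ℂ).comp (fderiv ℝ f z) := Complex.conjCLE.comp_fderiv
  simp only [wirtinger, h, map_mul, map_add, map_div₀, map_one, map_ofNat]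
  simp

lemma contDiffAt_wirtinger (hf : ContDiffAt ℝ ∞ f z) : ContDiffAt ℝ ∞ (wirtinger c k f) z := by
  have h : ContDiffAt ℝ ∞ (fderiv ℝ f) z := hf.fderiv_right (by simp)
  unfold wirtinger
  fun_prop

/-- Symmetry of the real second derivative suffices, since both operators are constant-coefficient
combinations of real directional derivatives. -/
lemma wirtinger_comm {c' : ℂ} {l : Fin n} (hf : ContDiffAt ℝ ∞ f z) :
    wirtinger c k (wirtinger c' l f) z = wirtinger c' l (wirtinger c k f) z := by
  have h : ContDiffAt ℝ ∞ (fderiv ℝ f) z := hf.fderiv_right (by simp)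
  have hd : DifferentiableAt ℝ (fderiv ℝ f) z := h.differentiableAt (by simp)
  have hs : IsSymmSndFDerivAt ℝ f z := hf.isSymmSndFDerivAt
    (by simpa using WithTop.coe_le_coe.2 (le_top : (2 : ℕ∞) ≤ ⊤))
  have key : ∀ (c : ℂ) (l : Fin n) (v : Fin n → ℂ), fderiv ℝ (wirtinger c l f) z v =
      (1 / 2) * (fderiv ℝ (fderiv ℝ f) z v (vecX l) + c * fderiv ℝ (fderiv ℝ f) z v (vecY l)) := by
    intro c l v
    have h1 : ∀ u, HasFDerivAt (fun w => fderiv ℝ f w u)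
        ((fderiv ℝ (fderiv ℝ f) z).flip u) z := fun u => by
      simpa using hd.hasFDerivAt.clm_apply (hasFDerivAt_const u z)
    have h2 := ((h1 (vecX l)).add ((h1 (vecY l)).const_mul c)).const_mul (1 / 2 : ℂ)
    have h3 : fderiv ℝ (wirtinger c l f) z = _ := h2.fderiv
    rw [h3]; simp; ring
  change 1 / 2 * (fderiv ℝ (wirtinger c' l f) z (vecX k) +
      c * fderiv ℝ (wirtinger c' l f) z (vecY k)) =
    1 / 2 * (fderiv ℝ (wirtinger c k f) z (vecX l) +
      c' * fderiv ℝ (wirtinger c k f) z (vecY l))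
  rw [key, key, key, key, hs.eq (vecX k) (vecX l), hs.eq (vecX k) (vecY l),
    hs.eq (vecY k) (vecX l), hs.eq (vecY k) (vecY l)]
  ring

end Wirtinger

/-! ### Matrix fields -/

section MatrixFields

open Matrix

variable {n : ℕ}

/-- The matrix field `A` is smooth near `z`. -/
def SmoothAt (A : MatrixField n) (z : Fin n → ℂ) : Prop :=
  ∀ i j, ContDiffAt ℝ ∞ (fun w => A w i j) z

/-- The entrywise Wirtinger derivative of a matrix field. -/
def matDeriv (c : ℂ) (k : Fin n) (A : MatrixField n) : MatrixField n := fun z =>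
  of fun i j => wirtinger c k (fun w => A w i j) z

variable {A B : MatrixField n} {c : ℂ} {k : Fin n} {z : Fin n → ℂ}

lemma SmoothAt.diff (hA : SmoothAt A z) (i j : Fin n) :
    DifferentiableAt ℝ (fun w => A w i j) z := (hA i j).differentiableAt (by simp)

lemma SmoothAt.mul (hA : SmoothAt A z) (hB : SmoothAt B z) :
    SmoothAt (fun w => A w * B w) z := by
  intro i j
  simp only [Matrix.mul_apply]
  exact ContDiffAt.sum fun m _ => (hA i m).mul (hB m j)

lemma SmoothAt.sub (hA : SmoothAt A z) (hB : SmoothAt B z) :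
    SmoothAt (fun w => A w - B w) z := fun i j => (hA i j).sub (hB i j)

lemma SmoothAt.matDeriv (hA : SmoothAt A z) : SmoothAt (matDeriv c k A) z :=
  fun i j => contDiffAt_wirtinger (hA i j)

lemma SmoothAt.det (hA : SmoothAt A z) : ContDiffAt ℝ ∞ (fun w => (A w).det) z := by
  simp only [det_apply']
  exact ContDiffAt.sum fun σ _ => contDiffAt_const.mul (contDiffAt_prod fun i _ => hA _ _)

lemma SmoothAt.inv (hA : SmoothAt A z) (h : (A z).det ≠ 0) : SmoothAt (fun w => (A w)⁻¹) z := by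
  intro i j
  simp only [inv_def, Ring.inverse_eq_inv', Matrix.smul_apply, smul_eq_mul, adjugate_apply]
  refine (hA.det.inv h).mul
    (SmoothAt.det (A := fun w => (A w).updateRow j (Pi.single i 1)) fun a b => ?_)
  simp only [updateRow_apply]
  split_ifs
  · exact contDiffAt_const
  · exact hA a b

lemma matDeriv_mul (hA : SmoothAt A z) (hB : SmoothAt B z) :
    matDeriv c k (fun w => A w * B w) z = matDeriv c k A z * B z + A z * matDeriv c k B z := by
  ext i j
  simp only [matDeriv, of_apply, Matrix.mul_apply, Matrix.add_apply]
  rw [← Finset.sum_add_distrib]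
  refine (wirtinger_sum (F := fun m w => A w i m * B w m j)
    fun m _ => (hA.diff i m).mul (hB.diff m j)).trans ?_
  exact Finset.sum_congr rfl fun m _ => wirtinger_mul (hA.diff i m) (hB.diff m j)

lemma matDeriv_add (hA : SmoothAt A z) (hB : SmoothAt B z) :
    matDeriv c k (fun w => A w + B w) z = matDeriv c k A z + matDeriv c k B z := by
  ext i j
  exact wirtinger_add (hA.diff i j) (hB.diff i j)

lemma matDeriv_sub (hA : SmoothAt A z) (hB : SmoothAt B z) :
    matDeriv c k (fun w => A w - B w) z = matDeriv c k A z - matDeriv c k B z := by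
  ext i j
  exact wirtinger_sub (hA.diff i j) (hB.diff i j)

lemma wirtinger_trace (hA : SmoothAt A z) :
    wirtinger c k (fun w => trace (A w)) z = trace (matDeriv c k A z) :=
  wirtinger_sum fun i _ => hA.diff i i

lemma matDeriv_congr (h : A =ᶠ[nhds z] B) : matDeriv c k A z = matDeriv c k B z := by
  ext i j
  exact wirtinger_congr (h.mono fun w hw => congrFun (congrFun hw i) j)

/-- Differentiate A⁻¹A = 1, which holds near z because the determinant stays nonzero there. -/
lemma matDeriv_inv (hA : SmoothAt A z) (h : (A z).det ≠ 0) :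
    matDeriv c k (fun w => (A w)⁻¹) z = -((A z)⁻¹ * matDeriv c k A z * (A z)⁻¹) := by
  have hI := hA.inv h
  have h1 : (fun w => (A w)⁻¹ * A w) =ᶠ[nhds z] fun _ => 1 := by
    filter_upwards [hA.det.continuousAt.eventually_ne h] with w hw
    exact nonsing_inv_mul _ (isUnit_iff_ne_zero.2 hw)
  have h2 : matDeriv c k (fun w => (A w)⁻¹ * A w) z = 0 := by
    rw [matDeriv_congr h1]
    ext i j
    exact wirtinger_const _
  rw [matDeriv_mul hI hA] at h2
  have h3 := congrArg (· * (A z)⁻¹) h2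
  simp only [add_mul, zero_mul, mul_assoc, mul_nonsing_inv _ (isUnit_iff_ne_zero.2 h),
    mul_one] at h3
  rw [mul_assoc, eq_neg_iff_add_eq_zero]
  exact h3

lemma matDeriv_conjTranspose (A : MatrixField n) :
    matDeriv c k (fun w => (A w)ᴴ) z = (matDeriv (conj c) k A z)ᴴ := by
  ext i j
  exact wirtinger_conj _

lemma matDeriv_comm {c' : ℂ} {l : Fin n} (hA : SmoothAt A z) :
    matDeriv c k (matDeriv c' l A) z = matDeriv c' l (matDeriv c k A) z := by
  ext i j
  exact wirtinger_comm (hA i j)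

end MatrixFields

/-! ### Contractions of pairs of three-index tensors -/

section Contraction

open Matrix

variable {n : ℕ}

/-- The contraction of `A_{i k ā}` and `B_{j̄ b l̄}` over `i, j̄` with `K`, over `k, l̄` with `L` and
over `ā, b` with `N`. -/
def contract (K L N : Matrix (Fin n) (Fin n) ℂ) (A B : Fin n → Matrix (Fin n) (Fin n) ℂ) : ℂ :=
  ∑ i, ∑ j, K j i * trace (A i * N * B j * L)

/-- Exchange of the two unbarred indices of `A_{i k ā}`. -/
def swapLeft (A : Fin n → Matrix (Fin n) (Fin n) ℂ) (i : Fin n) : Matrix (Fin n) (Fin n) ℂ :=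
  of fun k a => A k i a

/-- Exchange of the two barred indices of `B_{j̄ b l̄}`. -/
def swapRight (B : Fin n → Matrix (Fin n) (Fin n) ℂ) (j : Fin n) : Matrix (Fin n) (Fin n) ℂ :=
  of fun b l => B l b j

variable (K L N S : Matrix (Fin n) (Fin n) ℂ) (A A' B B' : Fin n → Matrix (Fin n) (Fin n) ℂ)

lemma contract_add_left : contract K L N (A + A') B = contract K L N A B + contract K L N A' B := by
  simp [contract, add_mul, mul_add, Finset.sum_add_distrib]

lemma contract_sub_left : contract K L N (A - A') B = contract K L N A B - contract K L N A' B := by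
  simp [contract, sub_mul, mul_sub, Finset.sum_sub_distrib]

lemma contract_add_right :
    contract K L N A (B + B') = contract K L N A B + contract K L N A B' := by
  simp [contract, add_mul, mul_add, Finset.sum_add_distrib]

lemma contract_sub_right :
    contract K L N A (B - B') = contract K L N A B - contract K L N A B' := by
  simp [contract, sub_mul, mul_sub, Finset.sum_sub_distrib]

lemma contract_neg_left : contract K L N (-A) B = -contract K L N A B := by
  simp [contract]

lemma contract_neg_right : contract K L N A (-B) = -contract K L N A B := by
  simp [contract]

/-- This and the next three lemmas absorb a matrix acting on one index of a tensor into the matrix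
contracting that index. All factors P H and H P thus end up in K, L, N. -/
lemma contract_mul_left :
    contract K L N (fun i => A i * S) B = contract K L (S * N) A B := by
  simp [contract, mul_assoc]

lemma contract_mul_right :
    contract K L N A (fun j => S * B j) = contract K L (N * S) A B := by
  simp [contract, mul_assoc]

lemma contract_smul_left :
    contract K L N (fun i => ∑ s, S i s • A s) B = contract (K * S) L N A B := by
  simp only [contract, trace_sum, Finset.mul_sum, Matrix.smul_mul, trace_smul,
    smul_eq_mul, Matrix.mul_apply, Finset.sum_mul]
  calc _ = ∑ i, ∑ s, ∑ j, K j i * (S i s * trace (A s * N * B j * L)) :=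
        Finset.sum_congr rfl fun i _ => Finset.sum_comm
    _ = ∑ s, ∑ i, ∑ j, K j i * (S i s * trace (A s * N * B j * L)) := Finset.sum_comm
    _ = _ := by
        refine Finset.sum_congr rfl fun s _ => ?_
        rw [Finset.sum_comm]
        simp only [mul_assoc]

lemma contract_smul_right :
    contract K L N A (fun j => ∑ s, S s j • B s) = contract (S * K) L N A B := by
  simp only [contract, trace_sum, Finset.mul_sum, Matrix.smul_mul,
    Matrix.mul_smul, trace_smul, smul_eq_mul, Matrix.mul_apply, Finset.sum_mul]
  refine Finset.sum_congr rfl fun i _ => ?_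
  rw [Finset.sum_comm]
  refine Finset.sum_congr rfl fun s _ => Finset.sum_congr rfl fun j _ => ?_
  ring

lemma sum_comm_pairs (f : Fin n → Fin n → Fin n → Fin n → ℂ) :
    ∑ i, ∑ j, ∑ k, ∑ l, f i j k l = ∑ k, ∑ l, ∑ i, ∑ j, f i j k l := by
  simp only [← Fintype.sum_prod_type' (f := fun i j => f i j _ _)]
  simp only [← Finset.univ_product_univ, Finset.sum_product]
  calc _ = ∑ i, ∑ k, ∑ j, ∑ l, f i j k l := Finset.sum_congr rfl fun i _ => Finset.sum_comm
    _ = ∑ k, ∑ i, ∑ j, ∑ l, f i j k l := Finset.sum_comm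
    _ = ∑ k, ∑ i, ∑ l, ∑ j, f i j k l :=
        Finset.sum_congr rfl fun k _ => Finset.sum_congr rfl fun i _ => Finset.sum_comm
    _ = _ := Finset.sum_congr rfl fun k _ => Finset.sum_comm

lemma trace_mul_four (A N B L : Matrix (Fin n) (Fin n) ℂ) :
    trace (A * N * B * L) = ∑ k, ∑ l, ∑ a, ∑ b, L l k * N a b * A k a * B b l := by
  simp only [trace, diag, Matrix.mul_apply, Finset.sum_mul]
  refine Finset.sum_congr rfl fun k _ => Finset.sum_congr rfl fun l _ => ?_
  rw [Finset.sum_comm]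
  refine Finset.sum_congr rfl fun a _ => Finset.sum_congr rfl fun b _ => ?_
  ring

lemma contract_eq_sum : contract K L N A B =
    ∑ i, ∑ j, ∑ k, ∑ l, ∑ a, ∑ b, K j i * L l k * N a b * A i k a * B j b l := by
  simp only [contract, trace_mul_four, Finset.mul_sum, ← mul_assoc]

/-- Relabelling i ↔ k and j̄ ↔ l̄ exchanges the roles of K and L. This is how symmetry or
antisymmetry of the tensors moves ρ from one pair of indices to the other. -/
lemma contract_swap :
    contract K L N (swapLeft A) (swapRight B) = contract L K N A B := by
  rw [contract_eq_sum, contract_eq_sum, sum_comm_pairs]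
  simp only [swapLeft, swapRight, of_apply]
  refine Finset.sum_congr rfl fun k _ => Finset.sum_congr rfl fun l _ =>
    Finset.sum_congr rfl fun i _ => Finset.sum_congr rfl fun j _ =>
    Finset.sum_congr rfl fun a _ => Finset.sum_congr rfl fun b _ => ?_
  ring

/-- Exchange of `i` with `k` and of `j̄` with `l̄` in a four-index tensor `F_{i j̄ k l̄}`. -/
lemma sum_trace_swap (F F' : Fin n → Fin n → Matrix (Fin n) (Fin n) ℂ)
    (h : ∀ i j k l, F i j k l = F' k l i j) :
    ∑ i, ∑ j, K j i * trace (F i j * L) = ∑ i, ∑ j, L j i * trace (F' i j * K) := by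
  simp only [trace, diag, Matrix.mul_apply, Finset.mul_sum]
  rw [sum_comm_pairs]
  refine Finset.sum_congr rfl fun k _ => Finset.sum_congr rfl fun l _ =>
    Finset.sum_congr rfl fun i _ => Finset.sum_congr rfl fun j _ => ?_
  rw [h]; ring

lemma contract_trace_mul_comm : ∑ i, ∑ j, K j i * trace (B j * L * A i * N) =
    contract K L N A B := by
  refine Finset.sum_congr rfl fun i _ => Finset.sum_congr rfl fun j _ => ?_
  rw [mul_assoc (B j * L), trace_mul_comm, ← mul_assoc]

/-- The algebraic part of the Bochner formula. Here `A`, `Ab` are the first derivatives of the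
metric, `C`, `Cb` those of the form, `W` are the mixed second derivatives of the form and `R` is the
curvature. -/
theorem bochner_algebra (H P : Matrix (Fin n) (Fin n) ℂ)
    (A Ab C Cb T Tb : Fin n → Matrix (Fin n) (Fin n) ℂ)
    (W R : Fin n → Fin n → Matrix (Fin n) (Fin n) ℂ)
    (hC : swapLeft C = C) (hCb : swapRight Cb = Cb)
    (hT : T = A - swapLeft A) (hTb : Tb = Ab - swapRight Ab)
    (hW : ∀ i j k l, W i j k l = W k l i j)
    (htr : ∀ i j, trace ((W i j - C i * H * Ab j - A i * H * Cb j + A i * H * P * H * Ab j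
      + P * H * R i j) * H) = 0) :
    (∑ i, ∑ j, H j i * trace ((W i j - C i * H * Ab j - A i * H * Cb j + A i * H * P * H * Ab j
        + P * H * R i j) * (H * P * H))) +
      contract H H H (fun i => C i - A i * (H * P)) (fun j => Cb j - P * H * Ab j) =
    contract H H H (fun i => C i - A i * (H * P) + ∑ s, (P * H) i s • T s)
        (fun j => Cb j - P * H * Ab j + ∑ s, (H * P) s j • Tb s) +
      ((∑ i, ∑ j, H j i * trace (R i j * (H * P * H * P * H)))
        - (∑ i, ∑ j, (H * P * H) j i * trace (R i j * (H * P * H)))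
        - (contract (H * P * H * P * H) H H T Tb - contract (H * P * H) H (H * P * H) T Tb)) := by
  set M := H * P * H with hM
  have hsT : swapLeft T = -T := by
    ext i k a; simp [hT, swapLeft]
  have hsTb : swapRight Tb = -Tb := by
    ext j b l; simp [hTb, swapRight]
  have hsA : swapLeft A = A - T := by rw [hT]; abel
  have hsAb : swapRight Ab = Ab - Tb := by rw [hTb]; abel
  set D : Fin n → Matrix (Fin n) (Fin n) ℂ := C - fun i => A i * (H * P) with hD
  set Db : Fin n → Matrix (Fin n) (Fin n) ℂ := Cb - fun j => P * H * Ab j with hDb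
  -- D is the Chern derivative of ρ. Since C is symmetric, its only asymmetry comes from the
  -- connection term, that is, from the torsion.
  have hsD : swapLeft D = D + fun i => T i * (H * P) := by
    have h1 : swapLeft D = swapLeft C - fun i => swapLeft A i * (H * P) := by
      ext i k a; simp [hD, swapLeft, Matrix.mul_apply]
    rw [h1, hC, hsA, hD]; ext i k a; simp [sub_mul]
    ring
  have hsDb : swapRight Db = Db + fun j => P * H * Tb j := by
    have h1 : swapRight Db = swapRight Cb - fun j => P * H * swapRight Ab j := by
      ext j b l; simp [hDb, swapRight, Matrix.mul_apply]
    rw [h1, hCb, hsAb, hDb]; ext i k a; simp [mul_sub]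
    ring
  have e1 : (fun i => C i - A i * (H * P) + ∑ s, (P * H) i s • T s)
      = D + fun i => ∑ s, (P * H) i s • T s := by
    ext i k a; simp [hD]
  have e2 : (fun j => Cb j - P * H * Ab j + ∑ s, (H * P) s j • Tb s)
      = Db + fun j => ∑ s, (H * P) s j • Tb s := by
    ext i k a; simp [hDb]
  have hMm : H * (P * H) = M := by rw [hM, mul_assoc]
  -- The cross terms of the square carry M on the pair (i, j̄). Antisymmetry of the torsion moves it
  -- to (k, l̄), where the cross terms of the second-order part live.
  have hX1 : contract M H H D Tb = -(contract H M H D Tb + contract H M M T Tb) := by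
    rw [← contract_swap H M, hsTb, contract_neg_right, hsD, contract_add_left, contract_mul_left]
  have hX2 : contract M H H T Db = -(contract H M H T Db + contract H M M T Tb) := by
    rw [← contract_swap H M, hsT, contract_neg_left, hsDb, contract_add_right,
      contract_mul_right, hMm]
  have hY : contract M H M T Tb = contract H M M T Tb := by
    rw [← contract_swap H M, hsT, hsTb, contract_neg_left, contract_neg_right, neg_neg]
  have hB : contract H H H (D + fun i => ∑ s, (P * H) i s • T s)
        (Db + fun j => ∑ s, (H * P) s j • Tb s) =
      contract H H H D Db + contract M H H D Tb + contract M H H T Db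
        + contract (M * P * H) H H T Tb := by
    rw [contract_add_left, contract_add_right, contract_add_right, contract_smul_left,
      contract_smul_right, contract_smul_left, contract_smul_right]
    have h3 : H * P * M = M * P * H := by rw [hM]; simp only [mul_assoc]
    rw [hMm, ← hM, h3]; ring
  -- Used twice: K = H, L = M gives the second-order part of the Laplacian, and K = M, L = H gives
  -- the vanishing contraction of the trace condition.
  have key : ∀ K L : Matrix (Fin n) (Fin n) ℂ,
      ∑ i, ∑ j, K j i * trace ((W i j - C i * H * Ab j - A i * H * Cb j + A i * H * P * H * Ab j
        + P * H * R i j) * L) =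
      (∑ i, ∑ j, K j i * trace (W i j * L)) - contract K L H C Ab - contract K L H A Cb
        + contract K L M A Ab + ∑ i, ∑ j, K j i * trace (R i j * (L * P * H)) := by
    intro K L
    simp only [contract, ← Finset.sum_add_distrib, ← Finset.sum_sub_distrib]
    refine Finset.sum_congr rfl fun i _ => Finset.sum_congr rfl fun j _ => ?_
    have : trace (P * H * R i j * L) = trace (R i j * (L * P * H)) := by
      rw [mul_assoc, trace_mul_comm]; simp only [mul_assoc]
    simp only [add_mul, sub_mul, trace_add, trace_sub, this, hM]
    simp only [mul_assoc]
    ring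
  have h0 := key M H
  simp only [htr, mul_zero, Finset.sum_const_zero] at h0
  have s1 : contract M H H C Ab = contract H M H C (Ab - Tb) := by
    rw [← contract_swap H M, hC, hsAb]
  have s2 : contract M H H A Cb = contract H M H (A - T) Cb := by
    rw [← contract_swap H M, hCb, hsA]
  have s3 : contract M H M A Ab = contract H M M (A - T) (Ab - Tb) := by
    rw [← contract_swap H M, hsAb, hsA]
  have hWs : ∑ i, ∑ j, M j i * trace (W i j * H) = ∑ i, ∑ j, H j i * trace (W i j * M) :=
    sum_trace_swap _ _ _ _ hW
  have d1 : contract H M H D Tb = contract H M H C Tb - contract H M M A Tb := by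
    rw [hD, contract_sub_left, contract_mul_left]
  have d2 : contract H M H T Db = contract H M H T Cb - contract H M M T Ab := by
    rw [hDb, contract_sub_right, contract_mul_right, hMm]
  have e3 : (fun i => C i - A i * (H * P)) = D := rfl
  have e4 : (fun j => Cb j - P * H * Ab j) = Db := rfl
  rw [key H M, e1, e2, hB, hX1, hX2, hY, e3, e4]
  rw [s1, s2, s3, hWs] at h0
  simp only [contract_sub_left, contract_sub_right] at h0
  have hMH : H * P * H = M := rfl
  rw [hMH] at h0
  linear_combination d1 + d2 - h0

end Contraction

/-! ### The Bochner formula in a coordinate domain -/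

section Local

open Matrix

variable {n : ℕ} {G P : MatrixField n} {z : Fin n → ℂ}

/-! ### Tensors in index notation rewritten as matrices -/

lemma traceForm_eq_trace (w : Fin n → ℂ) : traceForm G P w = trace (P w * (G w)⁻¹) := by
  simp [traceForm, gUp, trace, Matrix.mul_apply, mul_comm]

lemma formNormSq_eq_trace (w : Fin n → ℂ) :
    formNormSq G P w = trace (P w * (G w)⁻¹ * (P w * (G w)⁻¹)) := by
  rw [← mul_assoc, trace_mul_four, formNormSq, sum_comm_pairs]
  refine Finset.sum_congr rfl fun k _ => Finset.sum_congr rfl fun l _ => ?_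
  rw [Finset.sum_comm]
  refine Finset.sum_congr rfl fun a _ => Finset.sum_congr rfl fun b _ => ?_
  simp only [gUp]; ring

lemma formSq_eq_mul (w : Fin n → ℂ) : formSq G P w = P w * (G w)⁻¹ * P w := by
  ext k l
  simp only [formSq, gUp, of_apply, Matrix.mul_apply, Finset.sum_mul]
  refine Finset.sum_congr rfl fun a _ => Finset.sum_congr rfl fun b _ => ?_
  ring

/-- The convention g^{i j̄} = (G⁻¹)_{ji} transposes every tensor with upper indices. -/
lemma raise_eq_mul (A : MatrixField n) (i j : Fin n) (w : Fin n → ℂ) :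
    raise G A i j w = ((G w)⁻¹ * A w * (G w)⁻¹) j i := by
  simp only [raise, gUp, Matrix.mul_apply, Finset.sum_mul]
  rw [Finset.sum_comm]
  refine Finset.sum_congr rfl fun a _ => Finset.sum_congr rfl fun b _ => ?_
  ring

lemma chernGamma_eq_mul (k i j : Fin n) (w : Fin n → ℂ) :
    chernGamma G k i j w = (matDeriv (-Complex.I) k G w * (G w)⁻¹) i j := by
  simp [chernGamma, gUp, Matrix.mul_apply, matDeriv, dz_eq_wirtinger, mul_comm]

/-- The lowered torsion, as a family of matrices. -/
def torsionMatrix (G : MatrixField n) (z : Fin n → ℂ) : Fin n → Matrix (Fin n) (Fin n) ℂ :=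
  (fun i => matDeriv (-Complex.I) i G z) - swapLeft fun i => matDeriv (-Complex.I) i G z

lemma chernTorsionLow_eq (hG : (G z).det ≠ 0) (i k a : Fin n) :
    chernTorsionLow G i k a z = torsionMatrix G z i k a := by
  have h : ∀ i k, ∑ m, G z m a * (matDeriv (-Complex.I) i G z * (G z)⁻¹) k m =
      matDeriv (-Complex.I) i G z k a := by
    intro i k
    have h1 : matDeriv (-Complex.I) i G z * (G z)⁻¹ * G z = matDeriv (-Complex.I) i G z := by
      rw [mul_assoc, nonsing_inv_mul _ (isUnit_iff_ne_zero.2 hG), mul_one]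
    conv_rhs => rw [← h1]
    rw [Matrix.mul_apply]
    exact Finset.sum_congr rfl fun m _ => mul_comm _ _
  simp only [chernTorsionLow, chernTorsion, chernGamma_eq_mul, mul_sub, Finset.sum_sub_distrib, h]
  simp [torsionMatrix, swapLeft]

lemma torsionMatrix_antisymm (i k a : Fin n) :
    torsionMatrix G z i k a = -torsionMatrix G z k i a := by
  simp [torsionMatrix, swapLeft]

/-- The lowered curvature, as a family of matrices. -/
def curvatureMatrix (G : MatrixField n) (z : Fin n → ℂ) (i j : Fin n) :
    Matrix (Fin n) (Fin n) ℂ :=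
  matDeriv (-Complex.I) i G z * (G z)⁻¹ * matDeriv Complex.I j G z
    - matDeriv (-Complex.I) i (matDeriv Complex.I j G) z

/-- As a matrix, Γᵢ is ∂ᵢG · G⁻¹. Lowering an index multiplies by G on the right and cancels the
outer inverse in -∂_{j̄}Γᵢ. -/
lemma chernCurvatureLow_eq (hS : SmoothAt G z) (hG : (G z).det ≠ 0) (i j k l : Fin n) :
    chernCurvatureLow G i j k l z = curvatureMatrix G z i j k l := by
  have h1 : chernCurvatureLow G i j k l z =
      -(matDeriv Complex.I j (fun w => matDeriv (-Complex.I) i G w * (G w)⁻¹) z * G z) k l := by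
    simp only [chernCurvatureLow, chernCurvature, dzbar_eq_wirtinger, Matrix.mul_apply,
      ← Finset.sum_neg_distrib]
    refine Finset.sum_congr rfl fun m _ => ?_
    have : chernGamma G i k m = fun w => (matDeriv (-Complex.I) i G w * (G w)⁻¹) k m :=
      funext fun w => chernGamma_eq_mul i k m w
    rw [this, mul_comm, neg_mul]
    rfl
  have hu := nonsing_inv_mul _ (isUnit_iff_ne_zero.2 hG)
  rw [h1, matDeriv_mul hS.matDeriv (hS.inv hG), matDeriv_inv hS hG, matDeriv_comm hS, add_mul,
    mul_neg, neg_mul]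
  simp only [mul_assoc, hu, mul_one]
  simp only [curvatureMatrix, Matrix.add_apply, Matrix.neg_apply, Matrix.sub_apply, mul_assoc]
  ring

/-- The derivative `∇⁺` of the form `P`, as a family of matrices. -/
def bismutMatrix (G P : MatrixField n) (z : Fin n → ℂ) (i : Fin n) : Matrix (Fin n) (Fin n) ℂ :=
  matDeriv (-Complex.I) i P z - matDeriv (-Complex.I) i G z * ((G z)⁻¹ * P z)
    + ∑ s, (P z * (G z)⁻¹) i s • torsionMatrix G z s

/-- The Bismut coefficients in unbarred directions are the Chern ones with lower indices exchanged.
As closedness allows the same exchange in ∂ₖρ_{i m̄}, the result is the Chern derivative ∇ᵢρ_{k m̄}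
plus torsion contracted with ρ; hence the order i, k on the right. -/
lemma bismutDeriv_eq (hG : (G z).det ≠ 0) (hherm : (G z).IsHermitian)
    (hclosed : swapLeft (fun i => matDeriv (-Complex.I) i P z) =
      fun i => matDeriv (-Complex.I) i P z) (k i m : Fin n) :
    bismutDeriv G P k i m z = bismutMatrix G P z i k m := by
  have h1 : dz k (fun w => P w i m) z = matDeriv (-Complex.I) i P z k m := by
    rw [dz_eq_wirtinger]
    exact congrFun (congrFun (congrFun hclosed i) k) m
  have h2 : ∑ p, bismutA G k i p z * P z p m =
      (matDeriv (-Complex.I) i G z * ((G z)⁻¹ * P z)) k m := by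
    rw [← mul_assoc, Matrix.mul_apply]
    simp only [bismutA, chernGamma_eq_mul]
  have h3 : ∑ q, conj (bismutAbar G k m q z) * P z i q =
      -(∑ s, (P z * (G z)⁻¹) i s • torsionMatrix G z s) k m := by
    have hH : ∀ a b, conj ((G z)⁻¹ a b) = (G z)⁻¹ b a := fun a b => hherm.inv.apply b a
    simp only [bismutAbar, gUp, map_sum, map_mul, Complex.conj_conj, hH,
      chernTorsionLow_eq hG, Matrix.sum_apply, Matrix.smul_apply, smul_eq_mul, Matrix.mul_apply,
      Finset.sum_mul, ← Finset.sum_neg_distrib]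
    rw [Finset.sum_comm]
    refine Finset.sum_congr rfl fun s _ => Finset.sum_congr rfl fun q _ => ?_
    rw [torsionMatrix_antisymm k s]
    ring
  rw [bismutDeriv, h1, h2, h3, bismutMatrix]
  simp only [Matrix.add_apply, Matrix.sub_apply]
  ring

lemma bismutDerivNormSq_eq (hG : (G z).det ≠ 0) (hherm : (G z).IsHermitian)
    (hclosed : swapLeft (fun i => matDeriv (-Complex.I) i P z) =
      fun i => matDeriv (-Complex.I) i P z) :
    bismutDerivNormSq G P z = contract (G z)⁻¹ (G z)⁻¹ (G z)⁻¹ (bismutMatrix G P z)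
      fun j => (bismutMatrix G P z j)ᴴ := by
  rw [contract_eq_sum, sum_comm_pairs, bismutDerivNormSq]
  refine Finset.sum_congr rfl fun k _ => Finset.sum_congr rfl fun l _ =>
    Finset.sum_congr rfl fun i _ => Finset.sum_congr rfl fun j _ => ?_
  rw [Finset.sum_comm]
  refine Finset.sum_congr rfl fun q _ => Finset.sum_congr rfl fun p _ => ?_
  simp only [bismutDeriv_eq hG hherm hclosed, gUp, conjTranspose_apply]
  simp only [starRingEnd_apply]
  ring

/-- In T_{kp j̄} conj(T_{lq ī}) the first slots k, l meet L, the second slots p, q meet the inverse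
metric, and the last slots j, i meet K. -/
lemma sum_tensorQ_mul (hS : SmoothAt G z) (hG : (G z).det ≠ 0)
    (K L : Matrix (Fin n) (Fin n) ℂ) :
    ∑ i, ∑ j, ∑ k, ∑ l, tensorQ G i j k l z * (K j i * L l k) =
      (∑ i, ∑ j, K j i * trace (curvatureMatrix G z i j * L)) -
        contract L (G z)⁻¹ K (torsionMatrix G z) fun j => (torsionMatrix G z j)ᴴ := by
  rw [contract_eq_sum]
  have : ∀ f : Fin n → Fin n → Fin n → Fin n → Fin n → Fin n → ℂ,
      ∑ k, ∑ l, ∑ p, ∑ q, ∑ j, ∑ i, f k l p q j i =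
        ∑ i, ∑ j, ∑ k, ∑ l, ∑ p, ∑ q, f k l p q j i := by
    intro f
    calc _ = ∑ k, ∑ l, ∑ j, ∑ i, ∑ p, ∑ q, f k l p q j i :=
          Finset.sum_congr rfl fun k _ => Finset.sum_congr rfl fun l _ => sum_comm_pairs _
      _ = ∑ j, ∑ i, ∑ k, ∑ l, ∑ p, ∑ q, f k l p q j i := sum_comm_pairs _
      _ = _ := Finset.sum_comm
  rw [this]
  simp only [trace, diag, Matrix.mul_apply, Finset.mul_sum, ← Finset.sum_sub_distrib]
  refine Finset.sum_congr rfl fun i _ => Finset.sum_congr rfl fun j _ =>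
    Finset.sum_congr rfl fun k _ => Finset.sum_congr rfl fun l _ => ?_
  simp only [tensorQ, chernCurvatureLow_eq hS hG, chernTorsionLow_eq hG, sub_mul, Finset.sum_mul,
    conjTranspose_apply, gUp]
  congr 1
  · ring
  · refine Finset.sum_congr rfl fun p _ => Finset.sum_congr rfl fun q _ => ?_
    simp only [starRingEnd_apply]
    ring

/-- The Bochner formula for the components `G` of a Hermitian metric and `P` of a closed real
`(1,1)`-form of constant trace on an open set `U` of `ℂⁿ`. -/
theorem bochner_formula_of_isOpen {U : Set (Fin n → ℂ)} (hU : IsOpen U)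
    (hG : ∀ w ∈ U, SmoothAt G w) (hP : ∀ w ∈ U, SmoothAt P w)
    (hdet : ∀ w ∈ U, (G w).det ≠ 0)
    (hGherm : ∀ w ∈ U, (G w).IsHermitian) (hPherm : ∀ w ∈ U, (P w).IsHermitian)
    (hclosed : ∀ w ∈ U, ∀ i k m, dz i (fun w => P w k m) w = dz k (fun w => P w i m) w)
    {c : ℂ} (htrace : ∀ w ∈ U, traceForm G P w = c) (hz : z ∈ U) :
    chernLaplacian G (formNormSq G P) z = 2 * bismutDerivNormSq G P z +
      2 * ∑ i, ∑ j, ∑ k, ∑ l, tensorQ G i j k l z *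
        (gUp G z i j * raise G (formSq G P) k l z - raise G P i j z * raise G P k l z) := by
  have hUz : ∀ᶠ w in nhds z, w ∈ U := hU.mem_nhds hz
  set H := (G z)⁻¹ with hH
  set A : Fin n → Matrix (Fin n) (Fin n) ℂ := fun i => matDeriv (-Complex.I) i G z with hA
  set Ab : Fin n → Matrix (Fin n) (Fin n) ℂ := fun i => matDeriv Complex.I i G z with hAb
  set C : Fin n → Matrix (Fin n) (Fin n) ℂ := fun i => matDeriv (-Complex.I) i P z with hC
  set Cb : Fin n → Matrix (Fin n) (Fin n) ℂ := fun i => matDeriv Complex.I i P z with hCb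
  set W : Fin n → Fin n → Matrix (Fin n) (Fin n) ℂ :=
    fun i j => matDeriv (-Complex.I) i (matDeriv Complex.I j P) z with hW
  set S : MatrixField n := fun w => P w * (G w)⁻¹ with hS
  have hSs : ∀ w ∈ U, SmoothAt S w := fun w hw => (hP w hw).mul ((hG w hw).inv (hdet w hw))
  have hconj : ∀ {B : MatrixField n}, (∀ w ∈ U, (B w).IsHermitian) → ∀ w ∈ U, ∀ i,
      matDeriv Complex.I i B w = (matDeriv (-Complex.I) i B w)ᴴ := by
    intro B hB w hw i
    have h1 : B =ᶠ[nhds w] fun w => (B w)ᴴ :=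
      Filter.Eventually.mono (hU.mem_nhds hw) fun v hv => (hB v hv).symm
    rw [matDeriv_congr h1, matDeriv_conjTranspose, Complex.conj_I]
  have hcl : ∀ w ∈ U, ∀ i k m,
      matDeriv (-Complex.I) i P w k m = matDeriv (-Complex.I) k P w i m := by
    intro w hw i k m
    have := hclosed w hw i k m
    rwa [dz_eq_wirtinger] at this
  have hclb : ∀ w ∈ U, ∀ j b l,
      matDeriv Complex.I j P w b l = matDeriv Complex.I l P w b j := by
    intro w hw j b l
    rw [hconj hPherm w hw, hconj hPherm w hw, conjTranspose_apply, conjTranspose_apply,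
      hcl w hw]
  have hCs : swapLeft C = C := by
    ext i k a; exact hcl z hz k i a
  have hCbs : swapRight Cb = Cb := by
    ext j b l; exact hclb z hz l b j
  -- Conjugate closedness exchanges j̄ with l̄, closedness exchanges i with k. Both must hold near
  -- z, as they are differentiated once more.
  have hWs : ∀ i j k l, W i j k l = W k l i j := by
    intro i j k l
    have e1 : W i j k l = matDeriv (-Complex.I) i (matDeriv Complex.I l P) z k j :=
      wirtinger_congr (hUz.mono fun w hw => hclb w hw j k l)
    have e2 : matDeriv Complex.I l (matDeriv (-Complex.I) i P) z k j =
        matDeriv Complex.I l (matDeriv (-Complex.I) k P) z i j :=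
      wirtinger_congr (hUz.mono fun w hw => hcl w hw i k j)
    rw [e1, matDeriv_comm (hP z hz), e2, matDeriv_comm (hP z hz)]
  -- derivatives of the endomorphism `S`
  have hS1 : ∀ (c : ℂ) (i : Fin n), ∀ w ∈ U, matDeriv c i S w =
      (matDeriv c i P w - P w * (G w)⁻¹ * matDeriv c i G w) * (G w)⁻¹ := by
    intro c i w hw
    rw [hS, matDeriv_mul (hP w hw) ((hG w hw).inv (hdet w hw)),
      matDeriv_inv (hG w hw) (hdet w hw)]
    noncomm_ring
  -- The last two terms form the commutator of AᵢH with ∂_{j̄}S.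
  have hS2 : ∀ i j, matDeriv (-Complex.I) i (matDeriv Complex.I j S) z =
      (W i j - C i * H * Ab j - A i * H * Cb j + A i * H * P z * H * Ab j
        + P z * H * curvatureMatrix G z i j) * H
      + A i * H * (Cb j - P z * H * Ab j) * H - (Cb j - P z * H * Ab j) * H * A i * H := by
    intro i j
    have e : matDeriv Complex.I j S =ᶠ[nhds z] fun w =>
        (matDeriv Complex.I j P w - P w * (G w)⁻¹ * matDeriv Complex.I j G w) * (G w)⁻¹ :=
      hUz.mono fun w hw => hS1 _ j w hw
    have s1 : SmoothAt (fun w => P w * (G w)⁻¹ * matDeriv Complex.I j G w) z :=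
      (hSs z hz).mul (hG z hz).matDeriv
    rw [matDeriv_congr e, matDeriv_mul ((hP z hz).matDeriv.sub s1) ((hG z hz).inv (hdet z hz)),
      matDeriv_inv (hG z hz) (hdet z hz), matDeriv_sub (hP z hz).matDeriv s1,
      matDeriv_mul (hSs z hz) (hG z hz).matDeriv, hS1 _ i z hz, curvatureMatrix]
    simp only [hW, hA, hAb, hC, hCb, hS, ← hH]
    noncomm_ring
  -- the trace is constant
  have htr0 : ∀ i j, trace (matDeriv (-Complex.I) i (matDeriv Complex.I j S) z) = 0 := by
    intro i j
    have e : (fun w => trace (matDeriv Complex.I j S w)) =ᶠ[nhds z] fun _ => 0 := by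
      refine hUz.mono fun w hw => ?_
      have e1 : (fun w => trace (S w)) =ᶠ[nhds w] fun _ => c :=
        Filter.Eventually.mono (hU.mem_nhds hw) fun v hv => by
          rw [← htrace v hv, traceForm_eq_trace]
      simp only
      rw [← wirtinger_trace (hSs w hw), wirtinger_congr e1, wirtinger_const]
    rw [← wirtinger_trace (hSs z hz).matDeriv, wirtinger_congr e, wirtinger_const]
  have htr : ∀ i j, trace ((W i j - C i * H * Ab j - A i * H * Cb j + A i * H * P z * H * Ab j
      + P z * H * curvatureMatrix G z i j) * H) = 0 := by
    intro i j
    have h := htr0 i j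
    have h2 : trace (A i * H * (Cb j - P z * H * Ab j) * H) =
        trace ((Cb j - P z * H * Ab j) * H * A i * H) := by
      rw [mul_assoc (A i * H), trace_mul_comm, ← mul_assoc]
    rw [hS2, trace_sub, trace_add, h2] at h
    linear_combination h
  -- the Laplacian
  have hlap : ∀ i j, dz i (dzbar j (formNormSq G P)) z =
      2 * (trace ((W i j - C i * H * Ab j - A i * H * Cb j + A i * H * P z * H * Ab j
        + P z * H * curvatureMatrix G z i j) * (H * P z * H))
        + trace ((Cb j - P z * H * Ab j) * H * (C i - A i * (H * P z)) * H)) := by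
    intro i j
    have e0 : formNormSq G P = fun w => trace (S w * S w) := funext formNormSq_eq_trace
    have e1 : dzbar j (formNormSq G P) =ᶠ[nhds z] fun w =>
        trace (matDeriv Complex.I j (fun w => S w * S w) w) :=
      hUz.mono fun w hw => by
        rw [e0, dzbar_eq_wirtinger, wirtinger_trace ((hSs w hw).mul (hSs w hw))]
    have e2 : matDeriv Complex.I j (fun w => S w * S w) =ᶠ[nhds z] fun w =>
        matDeriv Complex.I j S w * S w + S w * matDeriv Complex.I j S w :=
      hUz.mono fun w hw => matDeriv_mul (hSs w hw) (hSs w hw)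
    have hs := hSs z hz
    have e3 : matDeriv (-Complex.I) i (fun w =>
        matDeriv Complex.I j S w * S w + S w * matDeriv Complex.I j S w) z =
        (matDeriv (-Complex.I) i (matDeriv Complex.I j S) z * S z
          + matDeriv Complex.I j S z * matDeriv (-Complex.I) i S z)
        + (matDeriv (-Complex.I) i S z * matDeriv Complex.I j S z
          + S z * matDeriv (-Complex.I) i (matDeriv Complex.I j S) z) := by
      rw [matDeriv_add (hs.matDeriv.mul hs) (hs.mul hs.matDeriv), matDeriv_mul hs.matDeriv hs,
        matDeriv_mul hs hs.matDeriv]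
    rw [dz_eq_wirtinger, wirtinger_congr e1, wirtinger_trace (hs.mul hs).matDeriv,
      matDeriv_congr e2, e3, trace_add, trace_add, trace_add,
      trace_mul_comm (S z), trace_mul_comm (matDeriv (-Complex.I) i S z), hS2, hS1 _ j z hz,
      hS1 _ i z hz]
    simp only [← hH, hS]
    -- Against P H, the commutator converts the factor C - P H A of ∂S into the Chern derivative C -
    -- A H P.
    have aux : ∀ X Y : Matrix (Fin n) (Fin n) ℂ,
        trace ((X * H + A i * H * Y * H - Y * H * A i * H) * (P z * H))
          + trace (Y * H * ((C i - P z * H * A i) * H)) =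
        trace (X * (H * P z * H)) + trace (Y * H * (C i - A i * (H * P z)) * H) := by
      intro X Y
      have t1 : trace (A i * H * Y * H * (P z * H)) =
          trace (Y * H * P z * H * A i * H) := by
        rw [mul_assoc (A i * H), mul_assoc (A i * H), trace_mul_comm]; simp only [mul_assoc]
      simp only [add_mul, sub_mul, mul_sub, trace_add, trace_sub, t1]
      simp only [mul_assoc]
      ring
    rw [two_mul, ← aux]
    ring
  -- conjugates of the torsion and of the derivative of the form
  have hTb : (fun j => (torsionMatrix G z j)ᴴ) = Ab - swapRight Ab := by
    ext j b l
    have h := hconj hGherm z hz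
    simp [torsionMatrix, swapLeft, swapRight, hAb, h]
  have hBb : (fun j => (bismutMatrix G P z j)ᴴ) = fun j => Cb j - P z * H * Ab j
      + ∑ s, (H * P z) s j • (torsionMatrix G z s)ᴴ := by
    funext j
    have hst : ∀ s, star ((P z * H) j s) = (H * P z) s j := fun s => by
      rw [← conjTranspose_apply, conjTranspose_mul, (hPherm z hz).eq, (hGherm z hz).inv.eq]
    have hHh : Hᴴ = H := (hGherm z hz).inv.eq
    simp only [bismutMatrix, conjTranspose_add, conjTranspose_sub, conjTranspose_sum,
      conjTranspose_smul, conjTranspose_mul, (hPherm z hz).eq, hAb, hCb,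
      hconj hGherm z hz, hconj hPherm z hz, ← hH, hHh, hst]
  have alg := bochner_algebra H (P z) A Ab C Cb (torsionMatrix G z)
    (fun j => (torsionMatrix G z j)ᴴ) W (curvatureMatrix G z) hCs hCbs rfl hTb hWs htr
  have hL : chernLaplacian G (formNormSq G P) z = 2 *
      ((∑ i, ∑ j, H j i * trace ((W i j - C i * H * Ab j - A i * H * Cb j
        + A i * H * P z * H * Ab j + P z * H * curvatureMatrix G z i j) * (H * P z * H))) +
      contract H H H (fun i => C i - A i * (H * P z)) (fun j => Cb j - P z * H * Ab j)) := by
    rw [← contract_trace_mul_comm]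
    simp only [chernLaplacian, hlap, gUp, ← hH, Finset.mul_sum, ← Finset.sum_add_distrib]
    refine Finset.sum_congr rfl fun i _ => Finset.sum_congr rfl fun j _ => ?_
    ring
  have hQ : ∑ i, ∑ j, ∑ k, ∑ l, tensorQ G i j k l z *
        (gUp G z i j * raise G (formSq G P) k l z - raise G P i j z * raise G P k l z) =
      (∑ i, ∑ j, ∑ k, ∑ l, tensorQ G i j k l z * (H j i * (H * P z * H * P z * H) l k)) -
      ∑ i, ∑ j, ∑ k, ∑ l, tensorQ G i j k l z * ((H * P z * H) j i * (H * P z * H) l k) := by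
    simp only [raise_eq_mul, formSq_eq_mul, gUp, ← hH, mul_sub, Finset.sum_sub_distrib, mul_assoc]
  rw [hL, alg, hQ, sum_tensorQ_mul (hG z hz) (hdet z hz), sum_tensorQ_mul (hG z hz) (hdet z hz),
    bismutDerivNormSq_eq (hdet z hz) (hGherm z hz) hCs, hBb]
  simp only [← hH]
  have hB : bismutMatrix G P z =
      fun i => C i - A i * (H * P z) + ∑ s, (P z * H) i s • torsionMatrix G z s := rfl
  rw [hB]
  ring

end Local

/-! ### Components of real bilinear forms on `ℂⁿ` -/

section Bilinear

open Matrix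

variable {n : ℕ}

lemma vecY_eq_smul (k : Fin n) : (vecY k : Fin n → ℂ) = Complex.I • vecX k := by
  simp [vecX, vecY, ← Pi.single_smul]

lemma I_smul_vecY (k : Fin n) : Complex.I • (vecY k : Fin n → ℂ) = -vecX k := by
  rw [vecY_eq_smul, smul_smul, Complex.I_mul_I, neg_one_smul]

lemma isHermitian_mixedComponent {B : (Fin n → ℂ) → (Fin n → ℂ) → ℝ}
    (hB : ∀ u v, B u v = B v u) : (of fun i j => mixedComponent B i j).IsHermitian := by
  ext i j
  simp only [conjTranspose_apply, of_apply, mixedComponent]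
  rw [hB (vecX j), hB (vecY j), hB (vecX j), hB (vecY j) (vecX i), ← starRingEnd_apply]
  simp only [map_mul, map_add, map_sub, Complex.conj_I, Complex.conj_ofReal, map_div₀, map_one,
    map_ofNat]
  ring

lemma isHermitian_neg_I_mul_mixedComponent {B : (Fin n → ℂ) → (Fin n → ℂ) → ℝ}
    (hB : ∀ u v, B u v = -B v u) :
    (of fun i j => -Complex.I * mixedComponent B i j).IsHermitian := by
  ext i j
  simp only [conjTranspose_apply, of_apply, mixedComponent]
  rw [hB (vecX j), hB (vecY j), hB (vecX j), hB (vecY j) (vecX i), ← starRingEnd_apply]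
  simp only [map_mul, map_add, map_sub, map_neg, Complex.conj_I, Complex.conj_ofReal, map_div₀,
    map_one, map_ofNat, Complex.ofReal_neg]
  ring

/-- The components of a positive definite real bilinear form which is invariant under the complex
structure form an invertible matrix. -/
lemma det_mixedComponent_ne_zero (B : (Fin n → ℂ) →ₗ[ℝ] (Fin n → ℂ) →ₗ[ℝ] ℝ)
    (hsymm : ∀ u v, B u v = B v u) (hpos : ∀ u, u ≠ 0 → 0 < B u u)
    (hinv : ∀ u v, B (Complex.I • u) (Complex.I • v) = B u v) :
    (of fun i j => mixedComponent (fun u v => B u v) i j : Matrix (Fin n) (Fin n) ℂ).det ≠ 0 := by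
  have hI : ∀ u v, B (Complex.I • u) v = -B u (Complex.I • v) := by
    intro u v
    rw [← hinv (Complex.I • u) v, smul_smul, Complex.I_mul_I, neg_one_smul, map_neg,
      LinearMap.neg_apply]
  -- The Hermitian form with real part B, complex linear in its first argument; its Gram matrix is
  -- twice the matrix of components.
  let h : (Fin n → ℂ) → (Fin n → ℂ) → ℂ := fun u v => B u v + Complex.I * B u (Complex.I • v)
  have hadd : ∀ u u' v, h (u + u') v = h u v + h u' v := by
    intro u u' v
    simp only [h, map_add, LinearMap.add_apply, Complex.ofReal_add]; ring
  have hsmul : ∀ (a : ℂ) u v, h (a • u) v = a * h u v := by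
    intro a u v
    have ha : a • u = a.re • u + a.im • (Complex.I • u) := by
      conv_lhs => rw [← Complex.re_add_im a, add_smul, mul_smul]
      rfl
    have hB : ∀ w, B (a • u) w = a.re * B u w - a.im * B u (Complex.I • w) := by
      intro w
      rw [ha, map_add, LinearMap.add_apply, map_smul, map_smul, LinearMap.smul_apply,
        LinearMap.smul_apply, hI, smul_eq_mul, smul_eq_mul]
      ring
    simp only [h, hB, smul_smul, Complex.I_mul_I, neg_one_smul, map_neg]
    push_cast
    conv_rhs => rw [← Complex.re_add_im a]
    linear_combination (-(a.im : ℂ) * B u (Complex.I • v)) * Complex.I_sq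
  have hconj : ∀ u v, h u v = conj (h v u) := by
    intro u v
    simp only [h, map_add, map_mul, Complex.conj_I, Complex.conj_ofReal]
    rw [hsymm u (Complex.I • v), hI, hsymm u v]
    push_cast; ring
  have hmix : ∀ i j, mixedComponent (fun u v => B u v) i j = 1 / 2 * h (vecX i) (vecX j) := by
    intro i j
    simp only [mixedComponent, h, vecY_eq_smul, hinv, hI]
    push_cast; ring
  have hexp : ∀ u v, h u v = ∑ i, u i * h (vecX i) v := by
    intro u v
    let L : (Fin n → ℂ) →ₗ[ℂ] ℂ :=
      { toFun := fun u => h u v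
        map_add' := fun u u' => hadd u u' v
        map_smul' := fun a u => hsmul a u v }
    change L u = ∑ i, u i * L (vecX i)
    conv_lhs => rw [pi_eq_sum_univ' u, map_sum]
    refine Finset.sum_congr rfl fun i _ => ?_
    rw [map_smul, smul_eq_mul]
    congr 2
  intro hdet
  obtain ⟨w, hw0, hw⟩ := exists_mulVec_eq_zero_iff.2 hdet
  -- The conjugate of w appears because h is conjugate linear in its second argument.
  have h1 : ∀ i, h (vecX i) (star w) = 0 := by
    intro i
    have h2 := congrFun hw i
    simp only [mulVec, dotProduct, of_apply, hmix, Pi.zero_apply] at h2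
    rw [hconj, hexp, map_sum]
    have h3 : ∑ j, conj (star w j * h (vecX j) (vecX i)) =
        2 * ∑ j, 1 / 2 * h (vecX i) (vecX j) * w j := by
      rw [Finset.mul_sum]
      refine Finset.sum_congr rfl fun j _ => ?_
      rw [map_mul, ← hconj, Pi.star_apply, ← starRingEnd_apply, Complex.conj_conj]
      ring
    rw [h3, h2, mul_zero]
  have h4 : h (star w) (star w) = 0 := by
    rw [hexp]; simp [h1]
  have h5 : B (star w) (star w) = 0 := by
    have := congrArg Complex.re h4
    simpa [h] using this
  exact (hpos _ (star_ne_zero.2 hw0)).ne' h5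

end Bilinear

/-! ### Components in holomorphic charts -/

section Charts

open Matrix

variable {n : ℕ} {X : Type*} [TopologicalSpace X] [ChartedSpace (Fin n → ℂ) X]
  {e : OpenPartialHomeomorph X (Fin n → ℂ)} {z : Fin n → ℂ}

lemma chartVec_I_smul (u : Fin n → ℂ) :
    chartVec e z (Complex.I • u) = Complex.I • chartVec e z u :=
  map_smul (mfderiv 𝓘(ℂ, Fin n → ℂ) 𝓘(ℂ, Fin n → ℂ) e.symm z) Complex.I u

/-- Needed for the metric to stay positive definite when pulled back to the chart. -/
lemma chartVec_injective [IsManifold 𝓘(ℂ, Fin n → ℂ) ω X] (he : e ∈ holCharts n X)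
    (hz : z ∈ e.target) : Function.Injective (chartVec e z) := by
  have h : e.MDifferentiable 𝓘(ℂ, Fin n → ℂ) 𝓘(ℂ, Fin n → ℂ) :=
    ⟨(contMDiffOn_of_mem_maximalAtlas he).mdifferentiableOn (by simp),
      (contMDiffOn_symm_of_mem_maximalAtlas he).mdifferentiableOn (by simp)⟩
  exact h.symm.mfderiv_injective hz

lemma contDiffAt_mixedComponent {B : (Fin n → ℂ) → (Fin n → ℂ) → (Fin n → ℂ) → ℝ}
    (hB : ∀ u v, ContDiffAt ℝ ∞ (fun w => B w u v) z) (i j : Fin n) :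
    ContDiffAt ℝ ∞ (fun w => mixedComponent (B w) i j) z := by
  have h : ∀ u v, ContDiffAt ℝ ∞ (fun w => (B w u v : ℂ)) z := fun u v =>
    Complex.ofRealCLM.contDiff.contDiffAt.comp z (hB u v)
  simp only [mixedComponent]
  exact contDiffAt_const.mul (((h _ _).add (h _ _)).add
    (contDiffAt_const.mul ((h _ _).sub (h _ _))))

namespace HermitianMetric

variable (g : HermitianMetric n X)

lemma smoothAt_comp (he : e ∈ holCharts n X) (hz : z ∈ e.target) : SmoothAt (g.comp e) z :=
  contDiffAt_mixedComponent fun u v =>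
    (g.smooth e he u v).contDiffAt (e.open_target.mem_nhds hz)

lemma isHermitian_comp : (g.comp e z).IsHermitian :=
  isHermitian_mixedComponent fun _ _ => g.symm _ _ _

lemma det_comp_ne_zero [IsManifold 𝓘(ℂ, Fin n → ℂ) ω X] (he : e ∈ holCharts n X)
    (hz : z ∈ e.target) : (g.comp e z).det ≠ 0 := by
  let L : (Fin n → ℂ) →ₗ[ℝ] TangentSpace 𝓘(ℂ, Fin n → ℂ) (e.symm z) := (chartVec e z).toLinearMap
  refine det_mixedComponent_ne_zero ((g.inner (e.symm z)).compl₁₂ L L)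
    (fun u v => g.symm _ _ _) (fun u hu => ?_) (fun u v => ?_)
  · refine g.pos _ _ fun h => hu (chartVec_injective he hz ?_)
    exact h.trans (map_zero L).symm
  · change g.inner _ (chartVec e z _) (chartVec e z _) = g.inner _ (chartVec e z _) (chartVec e z _)
    rw [chartVec_I_smul, chartVec_I_smul, g.invariant]

end HermitianMetric

namespace RealTwoForm

variable {ρ : RealTwoForm n X}

lemma inChart_I_smul (htype : ρ.IsOneOne) (u v : Fin n → ℂ) :
    ρ.inChart e z ![Complex.I • u, Complex.I • v] = ρ.inChart e z ![u, v] := by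
  have h : ∀ u v, ρ.inChart e z ![u, v] = ρ (e.symm z) ![chartVec e z u, chartVec e z v] := by
    intro u v
    rw [inChart, ContinuousAlternatingMap.compContinuousLinearMap_apply]
    congr 1
    ext i
    fin_cases i <;> rfl
  rw [h, h, chartVec_I_smul, chartVec_I_smul, htype]

lemma inChart_swap (u v : Fin n → ℂ) : ρ.inChart e z ![u, v] = -ρ.inChart e z ![v, u] := by
  have h := (ρ.inChart e z).map_swap ![v, u] (i := 0) (j := 1) (by simp)
  refine Eq.trans ?_ h
  change ρ.inChart e z _ = ρ.inChart e z _
  congr 1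
  ext i
  fin_cases i <;> rfl

lemma inChart_neg_left (u v : Fin n → ℂ) : ρ.inChart e z ![-u, v] = -ρ.inChart e z ![u, v] := by
  have h := (ρ.inChart e z).toMultilinearMap.cons_smul ![v] (-1) u
  simpa using h

lemma contDiffAt_inChart (hsmooth : ρ.IsSmooth) (he : e ∈ holCharts n X) (hz : z ∈ e.target) :
    ContDiffAt ℝ ∞ (ρ.inChart e) z :=
  (hsmooth e he).contDiffAt (e.open_target.mem_nhds hz)

lemma contDiffAt_inChart_apply (hsmooth : ρ.IsSmooth) (he : e ∈ holCharts n X)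
    (hz : z ∈ e.target) (v : Fin 2 → Fin n → ℂ) :
    ContDiffAt ℝ ∞ (fun w => ρ.inChart e w v) z := by
  have := contDiffAt_inChart hsmooth he hz
  exact ((ContinuousAlternatingMap.apply ℝ (Fin n → ℂ) ℝ v).contDiff.contDiffAt).comp z this

lemma smoothAt_comp (hsmooth : ρ.IsSmooth) (he : e ∈ holCharts n X) (hz : z ∈ e.target) :
    SmoothAt (ρ.comp e) z := fun i j =>
  contDiffAt_const.mul (contDiffAt_mixedComponent
    (B := fun w u v => ρ.inChart e w ![u, v])
    (fun u v => contDiffAt_inChart_apply hsmooth he hz ![u, v]) i j)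

lemma isHermitian_comp : (ρ.comp e z).IsHermitian :=
  isHermitian_neg_I_mul_mixedComponent fun u v => inChart_swap u v

lemma fderiv_inChart_cyclic (hsmooth : ρ.IsSmooth) (hclosed : ρ.IsClosedForm)
    (he : e ∈ holCharts n X) (hz : z ∈ e.target) (u v w : Fin n → ℂ) :
    fderiv ℝ (fun x => ρ.inChart e x ![v, w]) z u - fderiv ℝ (fun x => ρ.inChart e x ![u, w]) z v
      + fderiv ℝ (fun x => ρ.inChart e x ![u, v]) z w = 0 := by
  have h := extDeriv_apply
    ((contDiffAt_inChart hsmooth he hz).differentiableAt (by simp)) ![u, v, w]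
  rw [hclosed e he z hz] at h
  have r0 : (0 : Fin 3).removeNth ![u, v, w] = ![v, w] := by
    ext i; fin_cases i <;> rfl
  have r1 : (1 : Fin 3).removeNth ![u, v, w] = ![u, w] := by
    ext i; fin_cases i <;> rfl
  have r2 : (2 : Fin 3).removeNth ![u, v, w] = ![u, v] := by
    ext i; fin_cases i <;> rfl
  rw [Fin.sum_univ_three] at h
  simp only [r0, r1, r2] at h
  simp at h
  linarith

/-- This is the vanishing of dρ on (∂ᵢ, ∂ₖ, ∂_{m̄}): the term differentiating ρ(∂ᵢ, ∂ₖ) drops out by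
type. -/
lemma dz_comp_comm (hsmooth : ρ.IsSmooth) (htype : ρ.IsOneOne) (hclosed : ρ.IsClosedForm)
    (he : e ∈ holCharts n X) (hz : z ∈ e.target) (i k m : Fin n) :
    dz i (fun w => ρ.comp e w k m) z = dz k (fun w => ρ.comp e w i m) z := by
  let b : (Fin n → ℂ) → (Fin n → ℂ) → (Fin n → ℂ) → ℝ := fun u v w => ρ.inChart e w ![u, v]
  have hYY : ∀ i j, b (vecY i) (vecY j) = b (vecX i) (vecX j) := fun i j => by
    funext w
    simp only [b, vecY_eq_smul, inChart_I_smul htype]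
  have hYX : ∀ i j, b (vecY i) (vecX j) = fun w => -b (vecX i) (vecY j) w := fun i j => by
    funext w
    simp only [b]
    rw [← inChart_I_smul htype (vecY i), I_smul_vecY, inChart_neg_left, ← vecY_eq_smul]
  have hcomp : ∀ i j w, ρ.comp e w i j =
      (1 / 2) * ((b (vecX i) (vecY j) w : ℂ) - Complex.I * (b (vecX i) (vecX j) w : ℂ)) := by
    intro i j w
    have h1 := congrFun (hYY i j) w
    have h2 := congrFun (hYX i j) w
    simp only [b] at h1 h2 ⊢
    simp only [comp, of_apply, mixedComponent, h1, h2]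
    push_cast
    linear_combination (-(1 / 2) * (ρ.inChart e w ![vecX i, vecY j] : ℂ)) * Complex.I_sq
  have hd : ∀ i j (u : Fin n → ℂ), fderiv ℝ (fun w => ρ.comp e w i j) z u =
      (1 / 2) * ((fderiv ℝ (b (vecX i) (vecY j)) z u : ℂ)
        - Complex.I * (fderiv ℝ (b (vecX i) (vecX j)) z u : ℂ)) := by
    intro i j u
    have hb : ∀ u v, HasFDerivAt (fun w => (b u v w : ℂ))
        (Complex.ofRealCLM.comp (fderiv ℝ (b u v) z)) z := fun u v =>
      Complex.ofRealCLM.hasFDerivAt.comp z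
        ((contDiffAt_inChart_apply hsmooth he hz ![u, v]).differentiableAt (by simp)).hasFDerivAt
    have h := ((hb (vecX i) (vecY j)).sub ((hb (vecX i) (vecX j)).const_mul Complex.I)).const_mul
      (1 / 2 : ℂ)
    have h' := h.congr_of_eventuallyEq (Filter.Eventually.of_forall fun w => hcomp i j w)
    rw [h'.fderiv]
    simp
  have cyc := fun u v w => fderiv_inChart_cyclic hsmooth hclosed he hz u v w
  change ∀ u v w, fderiv ℝ (b v w) z u - fderiv ℝ (b u w) z v + fderiv ℝ (b u v) z w = 0 at cyc
  -- In c1 - c2 and c3 - c4 the derivatives of ρ(∂/∂xᵢ, ∂/∂xₖ) along the m-directions cancel. These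
  -- differences are `r1` and `r2`, the real and imaginary parts of the claim up to constants.
  have c1 := cyc (vecX i) (vecX k) (vecY m)
  have c2 := cyc (vecY i) (vecY k) (vecY m)
  have c3 := cyc (vecX i) (vecX k) (vecX m)
  have c4 := cyc (vecY i) (vecY k) (vecX m)
  simp only [hYY, hYX, fderiv_fun_neg, _root_.neg_apply] at c2 c4
  have r1 : (fderiv ℝ (b (vecX k) (vecY m)) z (vecX i) : ℂ)
      - fderiv ℝ (b (vecX k) (vecX m)) z (vecY i)
      - fderiv ℝ (b (vecX i) (vecY m)) z (vecX k)
      + fderiv ℝ (b (vecX i) (vecX m)) z (vecY k) = 0 := by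
    exact_mod_cast (by linarith : (_ : ℝ) = 0)
  have r2 : (fderiv ℝ (b (vecX k) (vecX m)) z (vecX i) : ℂ)
      + fderiv ℝ (b (vecX k) (vecY m)) z (vecY i)
      - fderiv ℝ (b (vecX i) (vecX m)) z (vecX k)
      - fderiv ℝ (b (vecX i) (vecY m)) z (vecY k) = 0 := by
    exact_mod_cast (by linarith : (_ : ℝ) = 0)
  simp only [dz, hd]
  linear_combination (1 / 4) * r1 - (Complex.I / 4) * r2 +
    (1 / 4) * (fderiv ℝ (b (vecX k) (vecX m)) z (vecY i)
      - fderiv ℝ (b (vecX i) (vecX m)) z (vecY k) : ℂ) * Complex.I_sq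

end RealTwoForm

end Charts

end HermitianGeometry

end

theorem mainTheorem2 {n : ℕ} {X : Type*} [TopologicalSpace X] [ChartedSpace (Fin n → ℂ) X]
    [IsManifold 𝓘(ℂ, Fin n → ℂ) ω X]
    (g : HermitianMetric n X) (ρ : RealTwoForm n X)
    (hsmooth : ρ.IsSmooth) (htype : ρ.IsOneOne) (hclosed : ρ.IsClosedForm)
    (htrace : ∃ c : ℝ, ∀ e ∈ holCharts n X, ∀ z ∈ e.target,
      traceForm (g.comp e) (ρ.comp e) z = c) :
    ∀ e ∈ holCharts n X, ∀ z ∈ e.target,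
      chernLaplacian (g.comp e) (formNormSq (g.comp e) (ρ.comp e)) z =
        2 * bismutDerivNormSq (g.comp e) (ρ.comp e) z +
        2 * ∑ i, ∑ j, ∑ k, ∑ l, tensorQ (g.comp e) i j k l z *
          (gUp (g.comp e) z i j * raise (g.comp e) (formSq (g.comp e) (ρ.comp e)) k l z -
            raise (g.comp e) (ρ.comp e) i j z * raise (g.comp e) (ρ.comp e) k l z) := by
  obtain ⟨c, hc⟩ := htrace
  intro e he z hz
  exact bochner_formula_of_isOpen e.open_target (fun w hw => g.smoothAt_comp he hw)
    (fun w hw => RealTwoForm.smoothAt_comp hsmooth he hw) (fun w hw => g.det_comp_ne_zero he hw)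
    (fun w _ => g.isHermitian_comp) (fun w _ => RealTwoForm.isHermitian_comp)
    (fun w hw => RealTwoForm.dz_comp_comm hsmooth htype hclosed he hw)
    (hc e he) hz
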